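/- All sets are subsets of $\omega$; $\subseteq^*$ and $=^*$ denote inclusion and equality up to finitely many elements. For a c.e. set $A$ let $\mathcal L(A)=\{W\cup A: W\text{ c.e.}\}$, ordered by inclusion, let $\mathcal D(A)=\{B\in\mathcal L(A): B-A\text{ is c.e.}\}$, and let $\mathcal L^*(A)$, $\mathcal D^*(A)$ be their quotients modulo finite sets. The c.e. set $A$ is *$\mathcal D$-maximal* if $\mathcal L^*(A)/\mathcal D^*(A)$ is the two-element Boolean algebra. It is *strongly $r$-separable* if for every c.e. set $B$ disjoint from $A$ there is a computable set $C$ with $B\subseteq C$, $A\subseteq\overline C$ and $C-B$ infinite. It is *Herrmann* if it is $\mathcal D$-maximal and strongly $r$-separable. A noncomputable c.e. set $A$ is *hemi-Herrmann* if there is a noncomputable c.e. set $B$ disjoint from $A$ such that $A\sqcup B$ is Herrmann. A collection $\mathcal G$ of c.e. sets *generates* $\mathcal D(A)$ if every member of $\mathcal G$ is disjoint from $A$ and every c.e. set $D$ disjoint from $A$ satisfies $D\subseteq^*\bigcup\mathcal F$ for some finite $\mathcal F\subseteq\mathcal G$. A generating set is of - Type 1 if it is $\{\emptyset\}$; - Type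 2 if it is $\{R\}$ with $R$ infinite and computable; - Type 3 if it is $\{W\}$ with $W$ an infinite noncomputable c.e. set; - Type 4 if it is $\{R_0,R_1,\ldots\}$, where the $R_i$ $(i\in\omega)$ are infinite pairwise disjoint computable sets; - Type 5 if it is $\{D_0,R_0,R_1,\ldots\}$, where $D_0$ is a noncomputable c.e. set, the $R_i$ $(i\in\omega)$ are computable, and all these sets are infinite and pairwise disjoint. For $n\in\{4,5\}$, a c.e. set $A$ *is Type $n$* if $\mathcal D(A)$ has a generating set of Type $n$ but none of Type $m$ for any $m<n$. **Lemma.** For every set $A\subseteq\omega$: (i) $A$ is $\mathcal D$-maximal and Type 4 if and only if $A$ is Herrmann; (ii) $A$ is $\mathcal D$-maximal and Type 5 if and only if $A$ is hemi-Herrmann. -/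

import Mathlib

namespace DMax

/-- `S` is a computably enumerable (c.e.) set of natural numbers. -/
def IsCE (S : Set ℕ) : Prop := REPred (fun n => n ∈ S)

/-- `S` is a computable set of natural numbers. -/
def IsComputable (S : Set ℕ) : Prop := ComputablePred (fun n => n ∈ S)

/-- `X ⊆* Y`: all but finitely many elements of `X` belong to `Y`. -/
def AlmostSubset (X Y : Set ℕ) : Prop := (X \ Y).Finite

/-- `X =* Y`: `X` and `Y` differ by finitely many elements. -/
def AlmostEq (X Y : Set ℕ) : Prop := AlmostSubset X Y ∧ AlmostSubset Y X

/-- The lattice `𝓛(A)` of all sets `W ∪ A` with `W` c.e., ordered by inclusion. -/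
def supersetLattice (A : Set ℕ) : Set (Set ℕ) := {X | ∃ W, IsCE W ∧ X = W ∪ A}

/-- The ideal `𝓓(A)` of all `B ∈ 𝓛(A)` such that `B - A` is c.e. -/
def idealD (A : Set ℕ) : Set (Set ℕ) := {B | B ∈ supersetLattice A ∧ IsCE (B \ A)}

/-- `X` and `Y` represent the same element of the quotient lattice `𝓛*(A) / 𝓓*(A)`: modulo finite
sets they have the same join with some member of the ideal. -/
def EquivModD (A X Y : Set ℕ) : Prop := ∃ I ∈ idealD A, AlmostEq (X ∪ I) (Y ∪ I)

/-- The c.e. set `A` is `𝓓`-maximal: the quotient `𝓛*(A) / 𝓓*(A)` is the two-element Boolean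
algebra, i.e. its bottom (the class of `A`) and its top (the class of `ℕ`) are different, and it
has no further element. -/
def IsDMaximal (A : Set ℕ) : Prop :=
  IsCE A ∧ ¬ EquivModD A A Set.univ ∧
    ∀ X ∈ supersetLattice A, EquivModD A X A ∨ EquivModD A X Set.univ

/-- The c.e. set `A` is strongly `r`-separable: every c.e. set `B` disjoint from `A` is contained in
a computable set `C` disjoint from `A` such that `C - B` is infinite. -/
def IsStronglyRSeparable (A : Set ℕ) : Prop :=
  IsCE A ∧ ∀ B, IsCE B → Disjoint B A →
    ∃ C, IsComputable C ∧ B ⊆ C ∧ A ⊆ Cᶜ ∧ (C \ B).Infinite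

/-- `A` is a Herrmann set. -/
def IsHerrmann (A : Set ℕ) : Prop := IsDMaximal A ∧ IsStronglyRSeparable A

/-- `A` is hemi-`P`: it is noncomputable and c.e., and for some noncomputable c.e. set `B` disjoint
from `A` the set `A ∪ B` satisfies `P`. -/
def Hemi (P : Set ℕ → Prop) (A : Set ℕ) : Prop :=
  IsCE A ∧ ¬ IsComputable A ∧
    ∃ B, IsCE B ∧ ¬ IsComputable B ∧ Disjoint A B ∧ P (A ∪ B)

/-- `A` is a hemi-Herrmann set. -/
def IsHemiHerrmann (A : Set ℕ) : Prop := Hemi IsHerrmann A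

/-- The collection `G` of c.e. sets generates `𝓓(A)`: its members are disjoint from `A`, and every
c.e. set disjoint from `A` is almost contained in the union of finitely many of them. -/
def Generates (G : Set (Set ℕ)) (A : Set ℕ) : Prop :=
  (∀ D ∈ G, IsCE D ∧ Disjoint D A) ∧
    ∀ D, IsCE D → Disjoint D A → ∃ F ⊆ G, F.Finite ∧ AlmostSubset D (⋃₀ F)

/-- `G` has the form `{∅}`. -/
def GenType1 (G : Set (Set ℕ)) : Prop := G = {∅}

/-- `G = {R}` with `R` infinite and computable. -/
def GenType2 (G : Set (Set ℕ)) : Prop := ∃ R, R.Infinite ∧ IsComputable R ∧ G = {R}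

/-- `G = {W}` with `W` infinite, c.e. and noncomputable. -/
def GenType3 (G : Set (Set ℕ)) : Prop :=
  ∃ W, W.Infinite ∧ IsCE W ∧ ¬ IsComputable W ∧ G = {W}

/-- `G = {R₀, R₁, …}` with the `Rᵢ` infinite, pairwise disjoint and computable. -/
def GenType4 (G : Set (Set ℕ)) : Prop :=
  ∃ R : ℕ → Set ℕ, (∀ i, (R i).Infinite ∧ IsComputable (R i)) ∧
    (∀ i j, i ≠ j → Disjoint (R i) (R j)) ∧ G = Set.range R

/-- `G = {D₀, R₀, R₁, …}` with all members infinite and pairwise disjoint, `D₀` c.e. and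
noncomputable, and the `Rᵢ` computable. -/
def GenType5 (G : Set (Set ℕ)) : Prop :=
  ∃ (D₀ : Set ℕ) (R : ℕ → Set ℕ), D₀.Infinite ∧ IsCE D₀ ∧ ¬ IsComputable D₀ ∧
    (∀ i, (R i).Infinite ∧ IsComputable (R i) ∧ Disjoint D₀ (R i)) ∧
    (∀ i j, i ≠ j → Disjoint (R i) (R j)) ∧ G = insert D₀ (Set.range R)

/-- Some collection of the form `T` generates `𝓓(A)`. -/
def HasGen (T : Set (Set ℕ) → Prop) (A : Set ℕ) : Prop := ∃ G, T G ∧ Generates G A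

/-- The c.e. set `A` is Type 4: `𝓓(A)` has a generating set of Type 4, but none of a smaller
Type. -/
def IsType4 (A : Set ℕ) : Prop :=
  IsCE A ∧ HasGen GenType4 A ∧ ¬ HasGen GenType1 A ∧ ¬ HasGen GenType2 A ∧ ¬ HasGen GenType3 A

/-- The c.e. set `A` is Type 5: `𝓓(A)` has a generating set of Type 5, but none of a smaller
Type. -/
def IsType5 (A : Set ℕ) : Prop :=
  IsCE A ∧ HasGen GenType5 A ∧ ¬ HasGen GenType1 A ∧ ¬ HasGen GenType2 A ∧
    ¬ HasGen GenType3 A ∧ ¬ HasGen GenType4 A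

end DMax

/-!
The ideal `𝓓(A)` is determined by the c.e. sets disjoint from `A`: a noncomputable c.e. set `A` is
`𝓓`-maximal when, modulo finite sets, each c.e. set `W` is either contained in `A ∪ D` or joined by
`A ∪ D` to all of `ℕ`, for some c.e. set `D` disjoint from `A`.

(i) A Type 4 generating set makes `A` strongly `r`-separable: a c.e. `B` disjoint from `A` is almost
covered by finitely many generators, and one further generator makes the difference infinite.
Conversely, swallowing the c.e. sets disjoint from `A` one after the other by strong
`r`-separability gives an increasing sequence of computable sets, whose successive differences
form a Type 4 generating set.

(ii) Let `A` be noncomputable and c.e., let `B` be c.e. and disjoint from `A`, and let all members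
of `𝓖` be disjoint from `B`. Then `A` is `𝓓`-maximal with `𝓓(A)` generated by `{B} ∪ 𝓖` precisely
when `A ∪ B` is `𝓓`-maximal with `𝓓(A ∪ B)` generated by `𝓖`, which reduces (ii) to (i). A
noncomputable `B` rules out Type 4, because a computable set separating `B` from `A` would differ
from `B` only by finitely many computable generators, modulo a finite set.
-/

namespace DMax

local infix:50 " ⊆* " => AlmostSubset

section Computability

variable {α : Type*} [Primcodable α] {p q : α → Prop}

theorem rePred_or (hp : REPred p) (hq : REPred q) : REPred fun a => p a ∨ q a := by
  obtain ⟨k, hk, hmem⟩ := Partrec.merge hp hq fun _ _ _ _ _ => rfl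
  refine (Partrec.dom_re hk).of_eq fun a => ?_
  simp [Part.dom_iff_mem, hmem]

theorem rePred_and (hp : REPred p) (hq : REPred q) : REPred fun a => p a ∧ q a := by
  have h : Partrec fun a => (Part.assert (p a) fun _ => Part.some ()).bind
      fun _ => Part.assert (q a) fun _ => Part.some () :=
    hp.bind (hq.comp Computable.fst).to₂
  refine (Partrec.dom_re h).of_eq fun a => ?_
  simp [Part.dom_iff_mem]

theorem countable_rePred : {p : α → Prop | REPred p}.Countable := by
  let f : {p : α → Prop | REPred p} → {f : ℕ →. ℕ // Partrec f} := fun p =>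
    ⟨_, Partrec.nat_iff.2 p.2⟩
  refine Function.Injective.countable (f := f) fun p q h => Subtype.ext (funext fun a => ?_)
  have hdom := congrArg Part.Dom (congrFun (congrArg Subtype.val h) (Encodable.encode a))
  simpa [f, Part.dom_iff_mem] using hdom

end Computability

section ComputableSets

variable {X Y F : Set ℕ}

theorem IsComputable.isCE (h : IsComputable X) : IsCE X := ComputablePred.to_re h

theorem isComputable_iff_isCE_compl : IsComputable X ↔ IsCE X ∧ IsCE Xᶜ :=
  ComputablePred.computable_iff_re_compl_re'

theorem IsCE.union (hX : IsCE X) (hY : IsCE Y) : IsCE (X ∪ Y) := rePred_or hX hY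

theorem IsComputable.compl (h : IsComputable X) : IsComputable Xᶜ := ComputablePred.not h

theorem IsComputable.union (hX : IsComputable X) (hY : IsComputable Y) :
    IsComputable (X ∪ Y) := by
  rw [isComputable_iff_isCE_compl, Set.compl_union]
  exact ⟨hX.isCE.union hY.isCE, rePred_and hX.compl.isCE hY.compl.isCE⟩

theorem IsComputable.sdiff (hX : IsComputable X) (hY : IsComputable Y) :
    IsComputable (X \ Y) := by
  have h := (hX.compl.union hY).compl
  rwa [Set.compl_union, compl_compl, ← Set.sdiff_eq] at h

theorem isComputable_empty : IsComputable ∅ := by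
  have h : PrimrecPred fun _ : ℕ => False :=
    Primrec.primrecPred (p := fun _ => False) (by simpa using Primrec.const false)
  exact h.computablePred

theorem isComputable_singleton (n : ℕ) : IsComputable {n} :=
  (Primrec.eq.comp Primrec.id (Primrec.const n)).computablePred

theorem supClosed_isComputable : SupClosed {X | IsComputable X} := fun _ hX _ hY => hX.union hY

theorem isComputable_sUnion {G : Set (Set ℕ)} (hG : G.Finite) (h : ∀ X ∈ G, IsComputable X) :
    IsComputable (⋃₀ G) :=
  supClosed_isComputable.sSup_mem hG isComputable_empty h

theorem isComputable_of_finite (hF : F.Finite) : IsComputable F := by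
  rw [← Set.biUnion_of_singleton F, ← Set.sUnion_image]
  exact isComputable_sUnion (hF.image _)
    (Set.forall_mem_image.2 fun n _ => isComputable_singleton n)

theorem infinite_of_not_isComputable (h : ¬ IsComputable X) : X.Infinite :=
  mt isComputable_of_finite h

end ComputableSets

section AlmostSubset

variable {X Y Z : Set ℕ}

theorem AlmostSubset.of_subset (h : X ⊆ Y) : X ⊆* Y := by
  simp [AlmostSubset, Set.sdiff_eq_empty.2 h]

theorem AlmostSubset.trans (hXY : X ⊆* Y) (hYZ : Y ⊆* Z) : X ⊆* Z :=
  (hXY.union hYZ).subset (sdiff_triangle X Y Z)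

theorem AlmostSubset.union_left (h : X ⊆* Y) (Z : Set ℕ) : Z ∪ X ⊆* Z ∪ Y :=
  Set.Finite.subset h fun _ hx =>
    ⟨hx.1.resolve_left fun hz => hx.2 (.inl hz), fun hy => hx.2 (.inr hy)⟩

theorem AlmostSubset.of_union_of_disjoint (h : X ⊆* Y ∪ Z) (hd : Disjoint X Y) : X ⊆* Z :=
  h.subset fun _ hx => ⟨hx.1, fun h => h.elim (Set.disjoint_left.1 hd hx.1) hx.2⟩

theorem AlmostSubset.finite_of_disjoint (h : X ⊆* Y) (hd : Disjoint X Y) : X.Finite := by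
  rwa [AlmostSubset, hd.sdiff_eq_left] at h

theorem IsComputable.union_of_almostSubset (hX : IsComputable X) (h : Y ⊆* X) :
    IsComputable (X ∪ Y) := by
  rw [← Set.union_sdiff_self]
  exact hX.union (isComputable_of_finite h)

theorem IsComputable.of_subset_of_almostSubset (hY : IsComputable Y) (hXY : X ⊆ Y)
    (hYX : Y ⊆* X) : IsComputable X := by
  rw [← Set.sdiff_sdiff_cancel_left hXY]
  exact hY.sdiff (isComputable_of_finite hYX)

end AlmostSubset

/-- The c.e. sets disjoint from `A`. Up to `D ↦ D ∪ A` these are the members of the ideal `𝓓(A)`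
(see `mem_idealD_iff`); working with the sets `D` themselves avoids carrying `A` along. -/
def ceDisjointFrom (A : Set ℕ) : Set (Set ℕ) := {D | IsCE D ∧ Disjoint D A}

section CEDisjointFrom

variable {A B D : Set ℕ}

theorem empty_mem_ceDisjointFrom (A : Set ℕ) : ∅ ∈ ceDisjointFrom A :=
  ⟨isComputable_empty.isCE, Set.empty_disjoint A⟩

theorem supClosed_ceDisjointFrom (A : Set ℕ) : SupClosed (ceDisjointFrom A) :=
  fun _ hX _ hY => ⟨hX.1.union hY.1, hX.2.union_left hY.2⟩

theorem union_mem_ceDisjointFrom (hB : B ∈ ceDisjointFrom A) (hD : D ∈ ceDisjointFrom A) :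
    B ∪ D ∈ ceDisjointFrom A :=
  supClosed_ceDisjointFrom A hB hD

theorem sUnion_mem_ceDisjointFrom {F : Set (Set ℕ)} (hF : F.Finite) (h : F ⊆ ceDisjointFrom A) :
    ⋃₀ F ∈ ceDisjointFrom A :=
  (supClosed_ceDisjointFrom A).sSup_mem hF (empty_mem_ceDisjointFrom A) h

theorem mem_ceDisjointFrom_union :
    D ∈ ceDisjointFrom (A ∪ B) ↔ D ∈ ceDisjointFrom A ∧ Disjoint D B := by
  simp only [ceDisjointFrom, Set.mem_ofPred_eq, Set.disjoint_union_right, and_assoc]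

theorem countable_ceDisjointFrom (A : Set ℕ) : (ceDisjointFrom A).Countable :=
  countable_rePred.mono fun _ hD => hD.1

theorem isComputable_iff_exists_univ_almostSubset (hA : IsCE A) :
    IsComputable A ↔ ∃ D ∈ ceDisjointFrom A, Set.univ ⊆* A ∪ D := by
  constructor
  · intro h
    exact ⟨Aᶜ, ⟨h.compl.isCE, disjoint_compl_left⟩, .of_subset (Set.union_compl_self A).ge⟩
  · rintro ⟨D, hD, h⟩
    refine isComputable_iff_isCE_compl.2 ⟨hA, ?_⟩
    have hcompl : Aᶜ = D ∪ Set.univ \ (A ∪ D) := by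
      rw [← Set.compl_eq_univ_sdiff, Set.compl_union, Set.union_inter_distrib_left,
        Set.union_compl_self, Set.inter_univ, eq_comm, Set.union_eq_right]
      exact hD.2.subset_compl_right
    rw [hcompl]
    exact hD.1.union (isComputable_of_finite h).isCE

end CEDisjointFrom

section DMaximal

variable {A B X Y : Set ℕ}

theorem mem_idealD_iff {I : Set ℕ} : I ∈ idealD A ↔ ∃ D ∈ ceDisjointFrom A, I = D ∪ A := by
  constructor
  · rintro ⟨⟨W, -, rfl⟩, hI⟩
    exact ⟨(W ∪ A) \ A, ⟨hI, Set.disjoint_sdiff_left⟩, by simp⟩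
  · rintro ⟨D, hD, rfl⟩
    refine ⟨⟨D, hD.1, rfl⟩, ?_⟩
    rw [Set.union_sdiff_right, hD.2.sdiff_eq_left]
    exact hD.1

theorem equivModD_iff (hX : A ⊆ X) (hY : A ⊆ Y) :
    EquivModD A X Y ↔ ∃ D ∈ ceDisjointFrom A, AlmostEq (X ∪ D) (Y ∪ D) := by
  have absorb : ∀ {Z D : Set ℕ}, A ⊆ Z → Z ∪ (D ∪ A) = Z ∪ D := fun {Z D} hZ => by
    rw [Set.union_comm D, ← Set.union_assoc, Set.union_eq_left.2 hZ]
  simp only [EquivModD, mem_idealD_iff]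
  constructor
  · rintro ⟨_, ⟨D, hD, rfl⟩, h⟩
    exact ⟨D, hD, by rwa [absorb hX, absorb hY] at h⟩
  · rintro ⟨D, hD, h⟩
    exact ⟨D ∪ A, ⟨D, hD, rfl⟩, by rwa [absorb hX, absorb hY]⟩

theorem equivModD_union_self_iff {W : Set ℕ} :
    EquivModD A (W ∪ A) A ↔ ∃ D ∈ ceDisjointFrom A, W ⊆* A ∪ D := by
  rw [equivModD_iff Set.subset_union_right subset_rfl]
  refine exists_congr fun D => and_congr_right fun _ => ?_
  have hsub : A ∪ D ⊆* W ∪ A ∪ D :=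
    .of_subset (Set.union_subset_union_left D Set.subset_union_right)
  rw [AlmostEq, and_iff_left hsub, AlmostSubset, Set.union_assoc, Set.union_sdiff_right,
    AlmostSubset]

theorem equivModD_univ_iff (hX : A ⊆ X) :
    EquivModD A X Set.univ ↔ ∃ D ∈ ceDisjointFrom A, Set.univ ⊆* X ∪ D := by
  rw [equivModD_iff hX (Set.subset_univ A)]
  refine exists_congr fun D => and_congr_right fun _ => ?_
  have hsub : X ∪ D ⊆* Set.univ := .of_subset (Set.subset_univ _)
  rw [Set.univ_union, AlmostEq, and_iff_right hsub]

theorem isDMaximal_iff : IsDMaximal A ↔ IsCE A ∧ ¬ IsComputable A ∧ ∀ W, IsCE W →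
    ∃ D ∈ ceDisjointFrom A, W ⊆* A ∪ D ∨ Set.univ ⊆* W ∪ A ∪ D := by
  refine and_congr_right fun hA => and_congr (not_congr ?_) ?_
  · rw [equivModD_univ_iff subset_rfl, isComputable_iff_exists_univ_almostSubset hA]
  · have hW : ∀ W, EquivModD A (W ∪ A) A ∨ EquivModD A (W ∪ A) Set.univ ↔
        ∃ D ∈ ceDisjointFrom A, W ⊆* A ∪ D ∨ Set.univ ⊆* W ∪ A ∪ D := fun W => by
      rw [equivModD_union_self_iff, equivModD_univ_iff Set.subset_union_right]
      simp only [and_or_left, exists_or]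
    simp only [supersetLattice, Set.mem_ofPred_eq, forall_exists_index, and_imp, ← hW]
    exact ⟨fun h W hW => h _ W hW rfl, fun h _ W hW hX => hX ▸ h W hW⟩

theorem IsDMaximal.of_union (hA : IsCE A) (hAc : ¬ IsComputable A) (hB : B ∈ ceDisjointFrom A)
    (h : IsDMaximal (A ∪ B)) : IsDMaximal A := by
  refine isDMaximal_iff.2 ⟨hA, hAc, fun W hW => ?_⟩
  obtain ⟨D, hD, h⟩ := (isDMaximal_iff.1 h).2.2 W hW
  refine ⟨B ∪ D, union_mem_ceDisjointFrom hB (mem_ceDisjointFrom_union.1 hD).1, ?_⟩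
  simpa only [Set.union_assoc] using h

end DMaximal

section Generates

variable {A B D : Set ℕ} {G : Set (Set ℕ)}

theorem generates_iff : Generates G A ↔ G ⊆ ceDisjointFrom A ∧
    ∀ D ∈ ceDisjointFrom A, ∃ F ⊆ G, F.Finite ∧ D ⊆* ⋃₀ F :=
  and_congr_right fun _ => forall_congr' fun _ => and_imp.symm

theorem generates_insert_iff : Generates (insert B G) A ↔
    B ∈ ceDisjointFrom A ∧ G ⊆ ceDisjointFrom A ∧
      ∀ D ∈ ceDisjointFrom A, ∃ F ⊆ G, F.Finite ∧ D ⊆* B ∪ ⋃₀ F := by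
  rw [generates_iff, Set.insert_subset_iff, and_assoc]
  refine and_congr_right fun _ => and_congr_right fun _ => forall₂_congr fun D _ => ?_
  constructor
  · rintro ⟨F, hFG, hF, h⟩
    refine ⟨F \ {B}, by simpa using hFG, hF.sdiff, h.trans (.of_subset ?_)⟩
    rw [← Set.sUnion_insert, Set.insert_sdiff_singleton]
    exact Set.sUnion_mono (Set.subset_insert B F)
  · rintro ⟨F, hFG, hF, h⟩
    exact ⟨insert B F, Set.insert_subset_insert hFG, hF.insert B, by rwa [Set.sUnion_insert]⟩

theorem Generates.exists_disjoint_of_infinite (hG : Generates G A) (hinf : G.Infinite)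
    (hdisj : G.PairwiseDisjoint id) (hD : D ∈ ceDisjointFrom A) :
    ∃ F ⊆ G, F.Finite ∧ D ⊆* ⋃₀ F ∧ ∃ S ∈ G, Disjoint S (⋃₀ F) := by
  obtain ⟨F, hFG, hF, hDF⟩ := (generates_iff.1 hG).2 D hD
  obtain ⟨S, hSG, hSF⟩ := hinf.exists_notMem_finite hF
  refine ⟨F, hFG, hF, hDF, S, hSG, Set.disjoint_sUnion_right.2 fun T hT => ?_⟩
  exact hdisj hSG (hFG hT) (ne_of_mem_of_not_mem hT hSF).symm

theorem Generates.not_generates_singleton (hG : Generates G A) (hGinf : G.Infinite)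
    (hdisj : G.PairwiseDisjoint id) (hinf : ∀ S ∈ G, S.Infinite) (W : Set ℕ) :
    ¬ Generates {W} A := by
  intro hW
  obtain ⟨hWA, hWgen⟩ := generates_iff.1 hW
  obtain ⟨F, -, -, hWF, S, hSG, hSF⟩ := hG.exists_disjoint_of_infinite hGinf hdisj (hWA rfl)
  obtain ⟨E, hEW, -, hSE⟩ := hWgen S ((generates_iff.1 hG).1 hSG)
  have hEW' : ⋃₀ E ⊆ W := Set.sUnion_subset fun T hT => (hEW hT).le
  exact hinf S hSG (((hSE.trans (.of_subset hEW')).trans hWF).finite_of_disjoint hSF)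

theorem not_hasGen_of_not_generates_singleton (h : ∀ W, ¬ Generates {W} A) :
    ¬ HasGen GenType1 A ∧ ¬ HasGen GenType2 A ∧ ¬ HasGen GenType3 A := by
  refine ⟨?_, ?_, ?_⟩
  · rintro ⟨_, rfl, hG⟩
    exact h _ hG
  · rintro ⟨_, ⟨R, -, -, rfl⟩, hG⟩
    exact h _ hG
  · rintro ⟨_, ⟨W, -, -, -, rfl⟩, hG⟩
    exact h _ hG

end Generates

section Type4

variable {A : Set ℕ} {G : Set (Set ℕ)}

theorem GenType4.infinite (h : GenType4 G) : G.Infinite := by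
  obtain ⟨R, hR, hdisj, rfl⟩ := h
  refine Set.infinite_range_of_injective fun i j hij => ?_
  by_contra hne
  have hempty : R j = ∅ := disjoint_self.1 (hij ▸ hdisj i j hne)
  exact (hR j).1.nonempty.ne_empty hempty

theorem GenType4.pairwiseDisjoint (h : GenType4 G) : G.PairwiseDisjoint id := by
  obtain ⟨R, -, hdisj, rfl⟩ := h
  rintro _ ⟨i, rfl⟩ _ ⟨j, rfl⟩ hij
  exact hdisj i j (ne_of_apply_ne R hij)

theorem GenType4.infinite_of_mem (h : GenType4 G) : ∀ S ∈ G, S.Infinite := by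
  obtain ⟨R, hR, -, rfl⟩ := h
  exact Set.forall_mem_range.2 fun i => (hR i).1

theorem GenType4.isComputable_of_mem (h : GenType4 G) : ∀ S ∈ G, IsComputable S := by
  obtain ⟨R, hR, -, rfl⟩ := h
  exact Set.forall_mem_range.2 fun i => (hR i).2

theorem isType4_iff : IsType4 A ↔ IsCE A ∧ HasGen GenType4 A := by
  refine and_congr_right fun _ => and_iff_left_of_imp ?_
  rintro ⟨G, hG₄, hG⟩
  exact not_hasGen_of_not_generates_singleton
    (hG.not_generates_singleton hG₄.infinite hG₄.pairwiseDisjoint hG₄.infinite_of_mem)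

theorem Generates.isStronglyRSeparable (hG : Generates G A) (hA : IsCE A) (hG₄ : GenType4 G) :
    IsStronglyRSeparable A := by
  refine ⟨hA, fun B hB hBA => ?_⟩
  obtain ⟨F, hFG, hF, hBF, S, hSG, hSF⟩ :=
    hG.exists_disjoint_of_infinite hG₄.infinite hG₄.pairwiseDisjoint ⟨hB, hBA⟩
  have hGA : G ⊆ ceDisjointFrom A := (generates_iff.1 hG).1
  have hFc : IsComputable (⋃₀ F) :=
    isComputable_sUnion hF fun T hT => hG₄.isComputable_of_mem T (hFG hT)
  have hFA : Disjoint (⋃₀ F) A := (sUnion_mem_ceDisjointFrom hF (hFG.trans hGA)).2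
  refine ⟨S ∪ (⋃₀ F ∪ B), (hG₄.isComputable_of_mem S hSG).union (hFc.union_of_almostSubset hBF),
    Set.subset_union_right.trans Set.subset_union_right,
    ((hGA hSG).2.union_left (hFA.union_left hBA)).subset_compl_left, ?_⟩
  refine ((hG₄.infinite_of_mem S hSG).sdiff hBF).mono fun x hx => ⟨.inl hx.1, fun hxB => ?_⟩
  exact hx.2 ⟨hxB, Set.disjoint_left.1 hSF hx.1⟩

theorem hasGen_genType4_of_monotone {C : ℕ → Set ℕ} (hC : Monotone C)
    (hcomp : ∀ n, IsComputable (C n)) (hCA : ∀ n, Disjoint (C n) A) (hzero : (C 0).Infinite)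
    (hsucc : ∀ n, (C (n + 1) \ C n).Infinite)
    (hcofinal : ∀ D ∈ ceDisjointFrom A, ∃ n, D ⊆* C n) : HasGen GenType4 A := by
  have hinf : ∀ n, (disjointed C n).Infinite
    | 0 => by rwa [disjointed_zero]
    | n + 1 => by
      have h := hC.disjointed_succ (not_isMax n)
      rw [Order.succ_eq_add_one] at h
      exact h ▸ hsucc n
  have hdcomp : ∀ n, IsComputable (disjointed C n) := fun n =>
    disjointedRec (fun _ i hX => IsComputable.sdiff hX (hcomp i)) (hcomp n)
  have hunion : ∀ n, ⋃₀ (disjointed C '' Set.Iic n) = C n := fun n => by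
    have h := biUnion_Iic_disjointed C n
    rw [hC.partialSups_eq] at h
    simpa only [Set.sUnion_image, Finset.mem_Iic, Set.mem_Iic] using h
  refine ⟨_, ⟨disjointed C, fun n => ⟨hinf n, hdcomp n⟩, fun i j hij => disjoint_disjointed C hij,
    rfl⟩, generates_iff.2 ⟨?_, fun D hD => ?_⟩⟩
  · exact Set.range_subset_iff.2 fun n =>
      ⟨(hdcomp n).isCE, (hCA n).mono_left (disjointed_subset C n)⟩
  · obtain ⟨n, hn⟩ := hcofinal D hD
    exact ⟨_, Set.image_subset_range _ (Set.Iic n), (Set.finite_Iic n).image _,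
      (hunion n).symm ▸ hn⟩

theorem IsStronglyRSeparable.hasGen_genType4 (h : IsStronglyRSeparable A) :
    HasGen GenType4 A := by
  obtain ⟨B, hB⟩ :=
    (countable_ceDisjointFrom A).exists_eq_range ⟨∅, empty_mem_ceDisjointFrom A⟩
  have hBA : ∀ n, B n ∈ ceDisjointFrom A := fun n => hB ▸ Set.mem_range_self n
  have hsep : ∀ D ∈ ceDisjointFrom A,
      ∃ C, IsComputable C ∧ D ⊆ C ∧ A ⊆ Cᶜ ∧ (C \ D).Infinite := fun D hD => h.2 D hD.1 hD.2
  choose! sep sep_computable subset_sep subset_compl_sep infinite_sep using hsep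
  have sep_mem : ∀ {D}, D ∈ ceDisjointFrom A → sep D ∈ ceDisjointFrom A := fun hD =>
    ⟨(sep_computable _ hD).isCE, Set.subset_compl_iff_disjoint_left.1 (subset_compl_sep _ hD)⟩
  let S : ℕ → Set ℕ := fun n => Nat.rec (B 0) (fun n X => sep X ∪ B (n + 1)) n
  have hS : ∀ n, S n ∈ ceDisjointFrom A := fun n => by
    induction n with
    | zero => exact hBA 0
    | succ n ih => exact union_mem_ceDisjointFrom (sep_mem ih) (hBA (n + 1))
  have hBS : ∀ n, B n ⊆ S n
    | 0 => subset_rfl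
    | _ + 1 => Set.subset_union_right
  have hsepS : ∀ n, sep (S n) ⊆ S (n + 1) := fun _ => Set.subset_union_left
  have hSsep : ∀ n, S n ⊆ sep (S n) := fun n => subset_sep _ (hS n)
  refine hasGen_genType4_of_monotone (C := fun n => sep (S n))
    (monotone_nat_of_le_succ fun n => (hsepS n).trans (hSsep (n + 1)))
    (fun n => sep_computable _ (hS n)) (fun n => (sep_mem (hS n)).2)
    ((infinite_sep _ (hS 0)).mono Set.sdiff_subset)
    (fun n => (infinite_sep _ (hS (n + 1))).mono (Set.sdiff_subset_sdiff_right (hsepS n)))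
    fun D hD => ?_
  obtain ⟨n, rfl⟩ : D ∈ Set.range B := hB ▸ hD
  exact ⟨n, .of_subset ((hBS n).trans (hSsep n))⟩

theorem isType4_iff_isStronglyRSeparable : IsType4 A ↔ IsStronglyRSeparable A := by
  rw [isType4_iff]
  exact ⟨fun ⟨hA, _, hG₄, hG⟩ => hG.isStronglyRSeparable hA hG₄,
    fun h => ⟨h.1, h.hasGen_genType4⟩⟩

theorem isDMaximal_and_isType4_iff_isHerrmann : IsDMaximal A ∧ IsType4 A ↔ IsHerrmann A :=
  and_congr_right fun _ => isType4_iff_isStronglyRSeparable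

end Type4

section Type5

variable {A B : Set ℕ} {G : Set (Set ℕ)}

theorem genType5_iff : GenType5 G ↔ ∃ B G₀, IsCE B ∧ ¬ IsComputable B ∧
    (∀ S ∈ G₀, Disjoint B S) ∧ GenType4 G₀ ∧ G = insert B G₀ := by
  constructor
  · rintro ⟨B, R, -, hB, hBc, hR, hdisj, rfl⟩
    exact ⟨B, _, hB, hBc, Set.forall_mem_range.2 fun i => (hR i).2.2,
      ⟨R, fun i => ⟨(hR i).1, (hR i).2.1⟩, hdisj, rfl⟩, rfl⟩
  · rintro ⟨B, _, hB, hBc, hBR, ⟨R, hR, hdisj, rfl⟩, rfl⟩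
    exact ⟨B, R, infinite_of_not_isComputable hBc, hB, hBc,
      fun i => ⟨(hR i).1, (hR i).2, hBR _ ⟨i, rfl⟩⟩, hdisj, rfl⟩

theorem IsStronglyRSeparable.isComputable_of_generates_insert (h : IsStronglyRSeparable A)
    (hG : Generates (insert B G) A) (hGc : ∀ S ∈ G, IsComputable S)
    (hBG : ∀ S ∈ G, Disjoint B S) : IsComputable B := by
  obtain ⟨hB, -, hgen⟩ := generates_insert_iff.1 hG
  obtain ⟨C, hC, hBC, hAC, -⟩ := h.2 B hB.1 hB.2
  obtain ⟨F, hFG, hF, hCF⟩ := hgen C ⟨hC.isCE, Set.subset_compl_iff_disjoint_left.1 hAC⟩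
  have hBF : Disjoint B (⋃₀ F) := Set.disjoint_sUnion_right.2 fun S hS => hBG S (hFG hS)
  have hFc : IsComputable (⋃₀ F) := isComputable_sUnion hF fun S hS => hGc S (hFG hS)
  refine (hC.sdiff hFc).of_subset_of_almostSubset (Set.subset_sdiff.2 ⟨hBC, hBF⟩) ?_
  rwa [AlmostSubset, Set.sdiff_sdiff, Set.union_comm]

theorem isType5_iff : IsType5 A ↔ IsCE A ∧ HasGen GenType5 A := by
  refine and_congr_right fun hA => and_iff_left_of_imp ?_
  rintro ⟨_, hG₅, hG⟩
  obtain ⟨B, G, -, hBc, hBG, hG₄, rfl⟩ := genType5_iff.1 hG₅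
  have hdisj : (insert B G).PairwiseDisjoint id :=
    hG₄.pairwiseDisjoint.insert fun S hS _ => hBG S hS
  have hinf : ∀ S ∈ insert B G, S.Infinite :=
    Set.forall_mem_insert.2 ⟨infinite_of_not_isComputable hBc, hG₄.infinite_of_mem⟩
  obtain ⟨h₁, h₂, h₃⟩ := not_hasGen_of_not_generates_singleton
    (hG.not_generates_singleton (hG₄.infinite.mono (Set.subset_insert B G)) hdisj hinf)
  refine ⟨h₁, h₂, h₃, fun h₄ => hBc ?_⟩
  have hsep : IsStronglyRSeparable A :=
    isType4_iff_isStronglyRSeparable.1 (isType4_iff.2 ⟨hA, h₄⟩)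
  exact hsep.isComputable_of_generates_insert hG hG₄.isComputable_of_mem hBG

theorem Generates.union_of_insert (hG : Generates (insert B G) A)
    (hBG : ∀ S ∈ G, Disjoint B S) : Generates G (A ∪ B) := by
  obtain ⟨-, hGA, hgen⟩ := generates_insert_iff.1 hG
  refine generates_iff.2
    ⟨fun S hS => mem_ceDisjointFrom_union.2 ⟨hGA hS, (hBG S hS).symm⟩, fun D hD => ?_⟩
  obtain ⟨hDA, hDB⟩ := mem_ceDisjointFrom_union.1 hD
  obtain ⟨F, hFG, hF, hDF⟩ := hgen D hDA
  exact ⟨F, hFG, hF, hDF.of_union_of_disjoint hDB⟩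

theorem IsDMaximal.union_of_generates_insert (hmax : IsDMaximal A)
    (hG : Generates (insert B G) A) (hBG : ∀ S ∈ G, Disjoint B S) : IsDMaximal (A ∪ B) := by
  obtain ⟨hA, hAc, hdich⟩ := isDMaximal_iff.1 hmax
  obtain ⟨hB, -, hgen⟩ := generates_insert_iff.1 hG
  have hGAB : G ⊆ ceDisjointFrom (A ∪ B) := (generates_iff.1 (hG.union_of_insert hBG)).1
  have hAB : IsCE (A ∪ B) := hA.union hB.1
  refine isDMaximal_iff.2 ⟨hAB, fun hABc => hAc ?_, fun W hW => ?_⟩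
  · obtain ⟨D, hD, h⟩ := (isComputable_iff_exists_univ_almostSubset hAB).1 hABc
    rw [Set.union_assoc] at h
    exact (isComputable_iff_exists_univ_almostSubset hA).2
      ⟨B ∪ D, union_mem_ceDisjointFrom hB (mem_ceDisjointFrom_union.1 hD).1, h⟩
  · obtain ⟨D, hD, h⟩ := hdich W hW
    obtain ⟨F, hFG, hF, hDF⟩ := hgen D hD
    have hcover : ∀ Z, Z ∪ D ⊆* Z ∪ B ∪ ⋃₀ F := fun Z => by
      rw [Set.union_assoc]
      exact hDF.union_left Z
    refine ⟨⋃₀ F, sUnion_mem_ceDisjointFrom hF (hFG.trans hGAB),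
      h.imp (fun h => h.trans (hcover A)) fun h => ?_⟩
    rw [← Set.union_assoc W]
    exact h.trans (hcover (W ∪ A))

theorem Generates.insert_of_union (hG : Generates G (A ∪ B)) (hmax : IsDMaximal (A ∪ B))
    (hA : IsCE A) (hAc : ¬ IsComputable A) (hB : B ∈ ceDisjointFrom A) :
    Generates (insert B G) A := by
  obtain ⟨hGAB, hgen⟩ := generates_iff.1 hG
  refine generates_insert_iff.2
    ⟨hB, fun S hS => (mem_ceDisjointFrom_union.1 (hGAB hS)).1, fun D hD => ?_⟩
  obtain ⟨E, hE, h | h⟩ := (isDMaximal_iff.1 hmax).2.2 D hD.1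
  · obtain ⟨F, hFG, hF, hEF⟩ := hgen E hE
    rw [Set.union_assoc] at h
    exact ⟨F, hFG, hF, (h.of_union_of_disjoint hD.2).trans (hEF.union_left B)⟩
  -- Here `D ∪ B ∪ E` is a c.e. set disjoint from `A` which almost covers the complement of `A`.
  · refine absurd ((isComputable_iff_exists_univ_almostSubset hA).2 ⟨D ∪ (B ∪ E), ?_, ?_⟩) hAc
    · exact union_mem_ceDisjointFrom hD
        (union_mem_ceDisjointFrom hB (mem_ceDisjointFrom_union.1 hE).1)
    · rwa [Set.union_left_comm, ← Set.union_assoc A, ← Set.union_assoc D]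

theorem isDMaximal_and_isType5_iff_isHemiHerrmann :
    IsDMaximal A ∧ IsType5 A ↔ IsHemiHerrmann A := by
  rw [isType5_iff]
  constructor
  · rintro ⟨hmax, hA, _, hG₅, hG⟩
    obtain ⟨B, G, hB, hBc, hBG, hG₄, rfl⟩ := genType5_iff.1 hG₅
    have hBA : B ∈ ceDisjointFrom A := (generates_insert_iff.1 hG).1
    exact ⟨hA, (isDMaximal_iff.1 hmax).2.1, B, hB, hBc, hBA.2.symm,
      hmax.union_of_generates_insert hG hBG,
      (hG.union_of_insert hBG).isStronglyRSeparable (hA.union hB) hG₄⟩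
  · rintro ⟨hA, hAc, B, hB, hBc, hAB, hmax, hsep⟩
    obtain ⟨G, hG₄, hG⟩ := hsep.hasGen_genType4
    have hBA : B ∈ ceDisjointFrom A := ⟨hB, hAB.symm⟩
    have hBG : ∀ S ∈ G, Disjoint B S := fun S hS =>
      (mem_ceDisjointFrom_union.1 ((generates_iff.1 hG).1 hS)).2.symm
    exact ⟨hmax.of_union hA hAc hBA, hA, insert B G,
      genType5_iff.2 ⟨B, G, hB, hBc, hBG, hG₄, rfl⟩, hG.insert_of_union hmax hA hAc hBA⟩

end Type5

end DMax

theorem lemma4p3 (A : Set ℕ) :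
    ((DMax.IsDMaximal A ∧ DMax.IsType4 A) ↔ DMax.IsHerrmann A) ∧
    ((DMax.IsDMaximal A ∧ DMax.IsType5 A) ↔ DMax.IsHemiHerrmann A) :=
  ⟨DMax.isDMaximal_and_isType4_iff_isHerrmann, DMax.isDMaximal_and_isType5_iff_isHemiHerrmann⟩
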